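/- Let $x\in\mathbb{C}$ be a root of unity and let $a\in\mathbb{C}\setminus\mathbb{Z}$. For $p\in\{1,2\}$, a complex number $c\notin\{0,-1,-2,\ldots\}$ and a root of unity $y$ with $(p,y)\neq(1,1)$, let $$\mathrm{Li}_p(y;c):=\sum_{n=1}^\infty\frac{y^n}{(n+c-1)^p}$$ be the cyclotomic Hurwitz zeta function (the limit of the partial sums, which exists), and let $\binom{z}{w}:=\frac{\Gamma(z+1)}{\Gamma(w+1)\Gamma(z-w+1)}$ be the generalized binomial coefficient, where $\binom{2n+2a}{n+a}^{-1}$ is interpreted as $0$ if $2n+2a$ is a negative integer. Then the series on the left-hand side below converges absolutely and $$\sum_{n=-\infty}^{\infty}\frac{4^{n+a}}{(n+a)^2\binom{2n+2a}{n+a}}\,x^{-n}=\mathrm{Li}_2(x;1-a)+x\,\mathrm{Li}_2(x^{-1};a)-2\bigl(\mathrm{Li}_1(x;1-a)-x\,\mathrm{Li}_1(x^{-1};a)\bigr)\log\bigl(1+\sqrt{1-x}\bigr),$$ where $4^{n+a}$, the square root and the logarithm take their principal values. For $x=1$, where the two $\mathrm{Li}_1$-series diverge separately, the difference $\mathrm{Li}_1(x;1-a)-x\,\mathrm{Li}_1(x^{-1};a)$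 is read as the convergent series $\sum_{n=1}^\infty\left(\frac{1}{n-a}-\frac{1}{n+a-1}\right)$; its coefficient $\log(1+\sqrt{1-x})$ vanishes, so the last term is $0$ in that case. -/

import Mathlib

open Filter Topology

noncomputable section

/-- The generalized binomial coefficient
`binom z w = Γ(z + 1) / (Γ(w + 1) Γ(z - w + 1))` for complex `z`, `w`. -/
def genBinom (z w : ℂ) : ℂ :=
  Complex.Gamma (z + 1) / (Complex.Gamma (w + 1) * Complex.Gamma (z - w + 1))

/-- The convention at the poles: if `z` is a negative integer, then the reciprocal
of `genBinom z w` is `0` (this is the value of `Γ(w + 1) Γ(z - w + 1) / Γ(z + 1)` as soon as `w` and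
`z - w` are not negative integers). -/
theorem inv_genBinom_of_neg_int (w : ℂ) (k : ℕ) : (genBinom (-((k : ℂ) + 1)) w)⁻¹ = 0 := by
  have h : Complex.Gamma (-((k : ℂ) + 1) + 1) = 0 := by
    have : (-((k : ℂ) + 1) + 1) = -(k : ℂ) := by ring
    rw [this, Complex.Gamma_neg_nat_eq_zero]
  rw [genBinom, h, zero_div, inv_zero]

/-- The `n`-th term, `n ∈ ℤ`, of the cyclotomic parametric Apéry-like series:
`4^(n+a) / ((n+a)^q binom(2n+2a, n+a)) * z^n`. -/
def aperyTerm (q : ℕ) (a z : ℂ) (n : ℤ) : ℂ :=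
  (4 : ℂ) ^ ((n : ℂ) + a) /
    (((n : ℂ) + a) ^ q * genBinom (2 * (n : ℂ) + 2 * a) ((n : ℂ) + a)) * z ^ n

/-- The terms of the cyclotomic Hurwitz zeta function
`Li_p(x; c) = ∑_{n ≥ 1} x^n / (n + c - 1)^p`, where the index is shifted to start at `0`. -/
def cycHurwitzTerm (p : ℕ) (x c : ℂ) (n : ℕ) : ℂ :=
  x ^ (n + 1) / ((n : ℂ) + c) ^ p

/-- The series defining `Li_p(x; c)` converges, as a limit of its partial sums. -/
def CycHurwitzConverges (p : ℕ) (x c : ℂ) : Prop :=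
  Summable (cycHurwitzTerm p x c) (SummationFilter.conditional ℕ)

/-- The cyclotomic Hurwitz zeta function `Li_p(x; c)`, the limit of the partial sums
(the convergence may be only conditional when `p = 1`). -/
def cycHurwitz (p : ℕ) (x c : ℂ) : ℂ :=
  ∑'[SummationFilter.conditional ℕ] n, cycHurwitzTerm p x c n

end

/-! Put s = n + a. By Legendre duplication the n-th term is x^(-n) B(s, 1/2) / s, and expanding (1 -
t)^(-1/2) in the Beta integral gives B(s, 1/2) = ∑ c_m / (s + m) with c_m = (1/2)_m / m!. So the
series is a double sum of c_m x^(-n) / (s (s + m)).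

The column m = 0 is ∑ x^(-n) / s^2, which yields the two Li_2 values (`hasSum_zpow_div_sq`). For m ≥
1, 1 / (s (s + m)) = (1/m)(1/s - 1/(s + m)). Formally ∑ x^(-n) / s = -L, where L is the Li_1
difference, and the shift by m multiplies this by x^m, so the column is -L (c_m / m)(1 - x^m)
(`hasSum_zpow_mul_sub`). Finally ∑ (c_m / m)(1 - x^m) = 2 log(1 + √(1 - x))
(`hasSum_halfCoeff_div_mul_one_sub_pow`).

The interchange is legitimate because the part m ≥ 1 converges absolutely
(`summable_halfCoeff_double`), thanks to c_m = O(m^(-1/2)). -/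

noncomputable section

/-! ### The coefficients (1/2)_n / n! and their decay -/

/-- The coefficients `(1/2)_n / n!` of the power series of `(1 - x) ^ (-1/2)`. -/
def halfCoeff : ℕ → ℝ
  | 0 => 1
  | n + 1 => halfCoeff n * ((2 * n + 1) / (2 * n + 2))

theorem halfCoeff_succ (n : ℕ) :
    halfCoeff (n + 1) = halfCoeff n * ((2 * n + 1) / (2 * n + 2)) := rfl

theorem halfCoeff_pos (n : ℕ) : 0 < halfCoeff n := by
  induction n with
  | zero => simp [halfCoeff]
  | succ n ih => rw [halfCoeff_succ]; positivity

theorem halfCoeff_succ_mul (n : ℕ) :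
    (n + 1) * halfCoeff (n + 1) = (n + 1 / 2) * halfCoeff n := by
  rw [halfCoeff_succ]
  field_simp

theorem halfCoeff_succ_le (n : ℕ) : halfCoeff (n + 1) ≤ halfCoeff n := by
  rw [halfCoeff_succ]
  refine mul_le_of_le_one_right (halfCoeff_pos n).le ?_
  rw [div_le_one (by positivity)]
  linarith

/-- The left side decreases in n, because (2n + 1)(2n + 3) ≤ (2n + 2)^2. This is the source of the
n^(-1/2) decay. -/
theorem halfCoeff_sq_mul_le (n : ℕ) : halfCoeff n ^ 2 * (2 * n + 1) ≤ 1 := by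
  induction n with
  | zero => simp [halfCoeff]
  | succ n ih =>
    refine le_trans ?_ ih
    rw [halfCoeff_succ, mul_pow, mul_assoc]
    refine mul_le_mul_of_nonneg_left ?_ (by positivity)
    rw [div_pow, div_mul_eq_mul_div, div_le_iff₀ (by positivity)]
    push_cast
    nlinarith [(Nat.cast_nonneg n : (0 : ℝ) ≤ n)]

theorem halfCoeff_le (n : ℕ) : halfCoeff n ≤ ((n : ℝ) + 1) ^ (-(1 / 2) : ℝ) := by
  have h1 : halfCoeff n ^ 2 * (n + 1) ≤ 1 :=
    le_trans (mul_le_mul_of_nonneg_left (by linarith [(Nat.cast_nonneg n : (0 : ℝ) ≤ n)])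
      (sq_nonneg _)) (halfCoeff_sq_mul_le n)
  have hn : (0 : ℝ) < n + 1 := by positivity
  rw [Real.rpow_neg hn.le, ← Real.sqrt_eq_rpow, le_inv_comm₀ (halfCoeff_pos n) (by positivity),
    Real.sqrt_le_left (by have := halfCoeff_pos n; positivity), inv_pow,
    le_inv_comm₀ hn (by have := halfCoeff_pos n; positivity), ← one_div, le_div_iff₀ hn]
  exact h1

theorem halfCoeff_succ_le_rpow (n : ℕ) :
    halfCoeff (n + 1) ≤ ((n : ℝ) + 1) ^ (-(1 / 2) : ℝ) :=
  (halfCoeff_succ_le n).trans (halfCoeff_le n)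

theorem halfCoeff_le_one (n : ℕ) : halfCoeff n ≤ 1 :=
  (halfCoeff_le n).trans (Real.rpow_le_one_of_one_le_of_nonpos
    (by linarith [(Nat.cast_nonneg n : (0 : ℝ) ≤ n)]) (by norm_num))

theorem tendsto_halfCoeff : Tendsto halfCoeff atTop (𝓝 0) := by
  refine squeeze_zero (fun n => (halfCoeff_pos n).le) halfCoeff_le ?_
  have := (tendsto_rpow_neg_atTop (y := 1 / 2) (by norm_num)).comp
    ((tendsto_natCast_atTop_atTop (R := ℝ)).comp (tendsto_add_atTop_nat 1))
  refine this.congr fun n => ?_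
  simp

theorem summable_nat_succ_rpow_neg {p : ℝ} (hp : 1 < p) :
    Summable fun n : ℕ => ((n : ℝ) + 1) ^ (-p) := by
  have := (summable_nat_add_iff 1).2 (Real.summable_nat_rpow.2 (neg_lt_neg hp))
  simpa using this

theorem summable_halfCoeff_succ_mul_rpow {q : ℝ} (hq : 1 / 2 < q) :
    Summable fun n : ℕ => halfCoeff (n + 1) * ((n : ℝ) + 1) ^ (-q) := by
  refine Summable.of_nonneg_of_le (fun n => mul_nonneg (halfCoeff_pos _).le (by positivity))
    (fun n => ?_) (summable_nat_succ_rpow_neg (p := 1 / 2 + q) (by linarith))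
  rw [neg_add, Real.rpow_add (by positivity)]
  exact mul_le_mul_of_nonneg_right (halfCoeff_succ_le_rpow n) (by positivity)

theorem summable_halfCoeff_succ_div :
    Summable fun n : ℕ => halfCoeff (n + 1) / ((n : ℝ) + 1) := by
  refine (summable_halfCoeff_succ_mul_rpow (q := 1) (by norm_num)).congr fun n => ?_
  rw [Real.rpow_neg_one, div_eq_mul_inv]

/-! ### The logarithmic power series on the closed disc -/

theorem choose_add_sub_one_eq_halfCoeff (n : ℕ) :
    (Ring.choose ((1 / 2 : ℂ) + n - 1) n) = (halfCoeff n : ℂ) := by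
  have h : (Ring.choose ((1 / 2 : ℂ) + n - 1) n) = Ring.multichoose (1 / 2 : ℂ) n := by
    rw [Ring.choose]; congr 1; ring
  rw [h]
  induction n with
  | zero => simp [halfCoeff]
  | succ n ih =>
    have h1 := Ring.factorial_nsmul_multichoose_eq_ascPochhammer (1 / 2 : ℂ) n
    have h2 := Ring.factorial_nsmul_multichoose_eq_ascPochhammer (1 / 2 : ℂ) (n + 1)
    rw [Polynomial.ascPochhammer_smeval_eq_eval] at h1 h2
    rw [ascPochhammer_succ_eval, ← h1] at h2
    have ih' := ih (by rw [Ring.choose]; congr 1; ring)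
    rw [ih', nsmul_eq_mul, nsmul_eq_mul, Nat.factorial_succ] at h2
    push_cast at h2
    have hn : (n.factorial : ℂ) ≠ 0 := by exact_mod_cast n.factorial_ne_zero
    have hn1 : ((n : ℂ) + 1) ≠ 0 := by exact_mod_cast n.succ_ne_zero
    rw [halfCoeff_succ]
    push_cast
    have : (2 * (n : ℂ) + 2) ≠ 0 := by
      rw [show 2 * (n : ℂ) + 2 = 2 * (n + 1) by ring]; exact mul_ne_zero two_ne_zero hn1
    field_simp
    have h3 : (n.factorial : ℂ) * (((n : ℂ) + 1) * Ring.multichoose (1 / 2 : ℂ) (n + 1)) =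
      n.factorial * (halfCoeff n * (1 / 2 + n)) := by linear_combination h2
    have h4 := mul_left_cancel₀ hn h3
    linear_combination 2 * h4

/-- The binomial series of `(1 - x) ^ (-1/2)`. -/
theorem hasSum_halfCoeff {x : ℂ} (hx : ‖x‖ < 1) :
    HasSum (fun n : ℕ => (halfCoeff n : ℂ) * x ^ n) (1 / (1 - x) ^ (1 / 2 : ℂ)) := by
  have h := (Complex.one_div_one_sub_cpow_hasFPowerSeriesOnBall_zero (1 / 2 : ℂ)).hasSum
    (y := x) (by simpa [← ofReal_norm] using hx)
  simp only [zero_add] at h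
  simpa only [FormalMultilinearSeries.ofScalars_apply_eq, choose_add_sub_one_eq_halfCoeff, smul_eq_mul] using h

theorem one_sub_mem_slitPlane {x : ℂ} (hx : ‖x‖ < 1) : 1 - x ∈ Complex.slitPlane := by
  left
  have := (Complex.abs_re_le_norm x).trans_lt hx
  simp only [Complex.sub_re, Complex.one_re]
  linarith [abs_lt.1 this]

theorem cpow_half_sq (z : ℂ) : (z ^ (1 / 2 : ℂ)) ^ 2 = z := by
  rw [one_div]
  exact_mod_cast Complex.cpow_nat_inv_pow z two_ne_zero

theorem cpow_half_re_nonneg (z : ℂ) : 0 ≤ (z ^ (1 / 2 : ℂ)).re := by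
  rcases eq_or_ne z 0 with rfl | hz
  · rw [Complex.zero_cpow (by norm_num)]; simp
  rw [Complex.cpow_def_of_ne_zero hz, Complex.exp_re]
  have h1 := Complex.neg_pi_lt_log_im z
  have h2 := Complex.log_im_le_pi z
  have him : (Complex.log z * (1 / 2)).im = (Complex.log z).im / 2 := by
    rw [show Complex.log z * (1 / 2) = Complex.log z / 2 by ring]
    exact Complex.div_ofNat_im (Complex.log z) 2
  rw [him]
  exact mul_nonneg (Real.exp_pos _).le
    (Real.cos_nonneg_of_mem_Icc ⟨by linarith, by linarith⟩)

/-- A principal square root has nonnegative real part, so the logarithm stays away from its cut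
everywhere, including at the branch point z = 0. -/
theorem one_add_cpow_half_mem_slitPlane (z : ℂ) : 1 + z ^ (1 / 2 : ℂ) ∈ Complex.slitPlane := by
  left
  have := cpow_half_re_nonneg z
  simp only [Complex.add_re, Complex.one_re]
  linarith

theorem hasDerivAt_log_one_add_sqrt {x : ℂ} (hx : ‖x‖ < 1) :
    HasDerivAt (fun z : ℂ => 2 * Complex.log (1 + (1 - z) ^ (1 / 2 : ℂ)))
      (-(1 / ((1 - x) ^ (1 / 2 : ℂ) * (1 + (1 - x) ^ (1 / 2 : ℂ))))) x := by
  have h1 : HasDerivAt (fun z : ℂ => 1 - z) (-1) x := by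
    simpa using (hasDerivAt_id x).const_sub 1
  have h2 := h1.cpow_const (c := 1 / 2) (one_sub_mem_slitPlane hx)
  have h3 := ((h2.const_add 1).clog (one_add_cpow_half_mem_slitPlane _)).const_mul 2
  convert! h3 using 1
  have hx0 := Complex.slitPlane_ne_zero (one_sub_mem_slitPlane hx)
  rw [Complex.cpow_sub _ _ hx0, Complex.cpow_one]
  have hu := cpow_half_sq (1 - x)
  have hu1 := Complex.slitPlane_ne_zero (one_add_cpow_half_mem_slitPlane (1 - x))
  have hu0 : (1 - x) ^ (1 / 2 : ℂ) ≠ 0 := by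
    intro h; rw [h] at hu; simp at hu; exact hx0 hu.symm
  set u := (1 - x) ^ (1 / 2 : ℂ)
  rw [← hu]
  field_simp

/-- The power series `∑ c_n x ^ n / n`, `n ≥ 1`, with `c_n = (1/2)_n / n!`. -/
def halfLogSeries (x : ℂ) : ℂ :=
  ∑' n : ℕ, ((halfCoeff (n + 1) / ((n : ℝ) + 1) : ℝ) : ℂ) * x ^ (n + 1)

theorem norm_halfLogSeries_term_le {x : ℂ} (hx : ‖x‖ ≤ 1) (n : ℕ) :
    ‖((halfCoeff (n + 1) / ((n : ℝ) + 1) : ℝ) : ℂ) * x ^ (n + 1)‖ ≤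
      halfCoeff (n + 1) / ((n : ℝ) + 1) := by
  have h0 : 0 ≤ halfCoeff (n + 1) / ((n : ℝ) + 1) := by
    have := halfCoeff_pos (n + 1)
    positivity
  rw [norm_mul, Complex.norm_real, Real.norm_of_nonneg h0, norm_pow]
  exact mul_le_of_le_one_right h0 (pow_le_one₀ (norm_nonneg _) hx)

theorem summable_halfLogSeries {x : ℂ} (hx : ‖x‖ ≤ 1) :
    Summable fun n : ℕ => ((halfCoeff (n + 1) / ((n : ℝ) + 1) : ℝ) : ℂ) * x ^ (n + 1) :=
  Summable.of_norm_bounded summable_halfCoeff_succ_div (norm_halfLogSeries_term_le hx)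

theorem continuousOn_halfLogSeries : ContinuousOn halfLogSeries (Metric.closedBall 0 1) :=
  continuousOn_tsum (fun n => by fun_prop) summable_halfCoeff_succ_div
    (fun n x hx => norm_halfLogSeries_term_le (by simpa using hx) n)

theorem hasDerivAt_halfLogSeries {x : ℂ} (hx : ‖x‖ < 1) :
    HasDerivAt halfLogSeries (∑' n : ℕ, (halfCoeff (n + 1) : ℂ) * x ^ n) x := by
  obtain ⟨r, hxr, hr1⟩ := exists_between hx
  have hr0 : 0 ≤ r := (norm_nonneg x).trans hxr.le
  refine hasDerivAt_tsum_of_isPreconnected (t := Metric.ball (0 : ℂ) r) (y₀ := 0)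
    (g := fun (n : ℕ) (z : ℂ) => ((halfCoeff (n + 1) / ((n : ℝ) + 1) : ℝ) : ℂ) * z ^ (n + 1))
    (g' := fun (n : ℕ) (z : ℂ) => (halfCoeff (n + 1) : ℂ) * z ^ n) (u := fun n => r ^ n)
    (summable_geometric_of_lt_one hr0 hr1)
    Metric.isOpen_ball (convex_ball _ _).isPreconnected (fun n y _ => ?_) (fun n y hy => ?_) ?_ ?_ ?_
  · have := (hasDerivAt_pow (n + 1) y).const_mul
      (((halfCoeff (n + 1) / ((n : ℝ) + 1) : ℝ) : ℂ))
    convert! this using 1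
    have hn : ((n : ℂ) + 1) ≠ 0 := by exact_mod_cast n.succ_ne_zero
    push_cast
    field_simp
  · have hy' : ‖y‖ ≤ r := by simpa using (Metric.mem_ball.1 hy).le
    rw [norm_mul, Complex.norm_real, Real.norm_of_nonneg (halfCoeff_pos _).le, norm_pow]
    calc _ ≤ 1 * r ^ n := mul_le_mul (halfCoeff_le_one _) (pow_le_pow_left₀ (norm_nonneg _) hy' _)
          (by positivity) zero_le_one
      _ = r ^ n := one_mul _
  · simpa using (norm_nonneg x).trans_lt hxr
  · exact summable_halfLogSeries (by simp)
  · simpa using hxr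

/-- With u = √(1 - x), the sum is (1/u - 1)/x, and x = (1 - u)(1 + u). The result cancels the
derivative of 2 log(1 + u). -/
theorem tsum_halfCoeff_succ {x : ℂ} (hx : ‖x‖ < 1) :
    ∑' n : ℕ, (halfCoeff (n + 1) : ℂ) * x ^ n =
      1 / ((1 - x) ^ (1 / 2 : ℂ) * (1 + (1 - x) ^ (1 / 2 : ℂ))) := by
  have hx0 := Complex.slitPlane_ne_zero (one_sub_mem_slitPlane hx)
  have hu := cpow_half_sq (1 - x)
  have hu1 := Complex.slitPlane_ne_zero (one_add_cpow_half_mem_slitPlane (1 - x))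
  have hs := hasSum_halfCoeff hx
  rcases eq_or_ne x 0 with rfl | h0
  · rw [tsum_eq_single 0 (fun n hn => by simp [hn])]
    simp [halfCoeff]
    norm_num
  have h := (hasSum_nat_add_iff' 1).2 hs
  simp only [Finset.range_one, Finset.sum_singleton, pow_zero, mul_one] at h
  have h' := h.div_const x
  have e : (fun n : ℕ => (halfCoeff (n + 1) : ℂ) * x ^ (n + 1) / x) =
      fun n : ℕ => (halfCoeff (n + 1) : ℂ) * x ^ n := by
    funext n; rw [pow_succ]; field_simp
  rw [e] at h'
  rw [h'.tsum_eq]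
  have hu0 : (1 - x) ^ (1 / 2 : ℂ) ≠ 0 := by
    intro h; rw [h] at hu; simp at hu; exact hx0 hu.symm
  simp only [halfCoeff, Complex.ofReal_one]
  set u := (1 - x) ^ (1 / 2 : ℂ)
  have hxu : x = 1 - u ^ 2 := by rw [hu]; ring
  rw [div_eq_iff h0]
  field_simp
  rw [hxu]
  ring

theorem halfLogSeries_eq_of_lt {x : ℂ} (hx : ‖x‖ < 1) :
    halfLogSeries x = 2 * Complex.log 2 - 2 * Complex.log (1 + (1 - x) ^ (1 / 2 : ℂ)) := by
  have hd : ∀ y ∈ Metric.ball (0 : ℂ) 1, HasDerivAt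
      (fun z => halfLogSeries z + 2 * Complex.log (1 + (1 - z) ^ (1 / 2 : ℂ))) 0 y := by
    intro y hy
    have hy' : ‖y‖ < 1 := by simpa using hy
    have := (hasDerivAt_halfLogSeries hy').add (hasDerivAt_log_one_add_sqrt hy')
    rwa [tsum_halfCoeff_succ hy', add_neg_cancel] at this
  have key := Metric.isOpen_ball.is_const_of_deriv_eq_zero
    (convex_ball (0 : ℂ) 1).isPreconnected
    (fun y hy => (hd y hy).differentiableAt.differentiableWithinAt)
    (fun y hy => (hd y hy).deriv) (x := x) (y := 0) (by simpa using hx) (by simp)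
  have h0 : halfLogSeries 0 = 0 := by simp [halfLogSeries]
  simp only [h0, sub_zero, Complex.one_cpow, zero_add] at key
  rw [eq_sub_iff_add_eq, key]
  norm_num

/-- On the closed disc 1 - x has positive real part except at x = 1, where the power function is
continuous because its exponent has positive real part. This carries the closed form from the open
disc to the unit circle. -/
theorem continuousOn_log_one_add_sqrt :
    ContinuousOn (fun x : ℂ => Complex.log (1 + (1 - x) ^ (1 / 2 : ℂ)))
      (Metric.closedBall 0 1) := by
  refine ContinuousOn.clog (continuousOn_const.add fun x hx => ContinuousAt.continuousWithinAt ?_)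
    fun x _ => one_add_cpow_half_mem_slitPlane _
  have hsub : ContinuousAt (fun x : ℂ => 1 - x) x := by fun_prop
  by_cases h1 : x = 1
  · have h2 : ContinuousAt (fun z : ℂ => z ^ (1 / 2 : ℂ)) (1 - x) := by
      rw [h1, sub_self]
      have h3 := Complex.continuousAt_cpow_zero_of_re_pos (z := 1 / 2) (by norm_num)
      have h4 : ContinuousAt (fun z : ℂ => (z, (1 / 2 : ℂ))) 0 := by fun_prop
      exact ContinuousAt.comp (f := fun z : ℂ => (z, (1 / 2 : ℂ))) h3 h4
    exact ContinuousAt.comp (f := fun x : ℂ => 1 - x) h2 hsub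
  · refine hsub.cpow continuousAt_const ?_
    have hn : ‖x‖ ≤ 1 := by simpa using hx
    have hre := (Complex.abs_re_le_norm x).trans hn
    rcases (abs_le.1 hre).2.lt_or_eq with h | h
    · left; simp only [Complex.sub_re, Complex.one_re]; linarith
    · exfalso
      apply h1
      have h5 := Complex.sq_norm_sub_sq_re x
      have h6 : x.im = 0 := by nlinarith [norm_nonneg x, sq_nonneg x.im]
      exact Complex.ext (by simpa using h) (by simpa using h6)

/-- The power series `∑ c_n x ^ n / n` on the closed unit disc. -/
theorem halfLogSeries_eq {x : ℂ} (hx : ‖x‖ ≤ 1) :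
    halfLogSeries x = 2 * Complex.log 2 - 2 * Complex.log (1 + (1 - x) ^ (1 / 2 : ℂ)) := by
  have hcl : closure (Metric.ball (0 : ℂ) 1) = Metric.closedBall 0 1 :=
    closure_ball 0 one_ne_zero
  have h1 : ContinuousOn halfLogSeries (closure (Metric.ball 0 1)) :=
    hcl ▸ continuousOn_halfLogSeries
  have h2 : ContinuousOn (fun x : ℂ => 2 * Complex.log 2 -
      2 * Complex.log (1 + (1 - x) ^ (1 / 2 : ℂ))) (closure (Metric.ball 0 1)) :=
    hcl ▸ continuousOn_const.sub (continuousOn_const.mul continuousOn_log_one_add_sqrt)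
  have heq : Set.EqOn halfLogSeries (fun x : ℂ => 2 * Complex.log 2 -
      2 * Complex.log (1 + (1 - x) ^ (1 / 2 : ℂ))) (Metric.ball 0 1) :=
    fun y hy => halfLogSeries_eq_of_lt (by simpa using hy)
  exact heq.of_subset_closure h1 h2 subset_closure subset_rfl (hcl ▸ by simpa using hx)

/-- The difference of the values at 1 and at x, in which the constant 2 log 2 cancels. -/
theorem hasSum_halfCoeff_div_mul_one_sub_pow {x : ℂ} (hx : ‖x‖ ≤ 1) :
    HasSum (fun n : ℕ => ((halfCoeff (n + 1) / ((n : ℝ) + 1) : ℝ) : ℂ) * (1 - x ^ (n + 1)))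
      (2 * Complex.log (1 + (1 - x) ^ (1 / 2 : ℂ))) := by
  have h1 := (summable_halfLogSeries (x := 1) (by simp)).hasSum
  have h2 := (summable_halfLogSeries hx).hasSum
  change HasSum _ (halfLogSeries _) at h1
  change HasSum _ (halfLogSeries _) at h2
  have h := h1.sub h2
  rw [halfLogSeries_eq hx, halfLogSeries_eq (by simp), sub_self,
    Complex.zero_cpow (by norm_num), add_zero, Complex.log_one] at h
  convert! h using 1
  · funext n; ring
  · ring

/-! ### Partial fractions of the Beta function and the Apéry terms -/

theorem nat_add_ne_zero {s : ℂ} (hs : ∀ m : ℕ, s ≠ -m) (m : ℕ) : s + m ≠ 0 :=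
  fun h => hs m (eq_neg_of_add_eq_zero_left h)

/-- The partial fraction expansion of the Beta function `B(s, 1/2)` in the right half-plane. -/
theorem hasSum_halfCoeff_div_of_re_pos {s : ℂ} (hs : 0 < s.re) :
    HasSum (fun m : ℕ => (halfCoeff m : ℂ) / (s + m)) (Complex.betaIntegral s (1 / 2)) := by
  have hre (m : ℕ) : -1 < (s - 1 + m).re := by
    simp; linarith [(Nat.cast_nonneg m : (0 : ℝ) ≤ m)]
  have hint (m : ℕ) : ∫ t in (0 : ℝ)..1, (t : ℂ) ^ (s - 1 + m) = 1 / (s + m) := by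
    rw [integral_cpow (Or.inl (hre m))]
    have : s - 1 + m + 1 = s + m := by ring
    have h0 : s + m ≠ 0 := by
      intro h
      have := congrArg Complex.re h
      simp at this
      linarith [(Nat.cast_nonneg m : (0 : ℝ) ≤ m)]
    rw [this, Complex.ofReal_one, Complex.one_cpow, Complex.ofReal_zero, Complex.zero_cpow h0,
      sub_zero]
  have hintn (m : ℕ) : ∫ t in (0 : ℝ)..1, (t : ℝ) ^ (s.re - 1 + m) = 1 / (s.re + m) := by
    have hm : (0 : ℝ) ≤ m := Nat.cast_nonneg m
    rw [integral_rpow (Or.inl (by linarith))]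
    have : s.re - 1 + m + 1 = s.re + m := by ring
    rw [this, Real.one_rpow, Real.zero_rpow (by positivity), sub_zero]
  have hF : ∀ m : ℕ, MeasureTheory.Integrable
      (fun t : ℝ => (halfCoeff m : ℂ) * (t : ℂ) ^ (s - 1 + m))
      (MeasureTheory.volume.restrict (Set.Ioc 0 1)) := by
    intro m
    have := intervalIntegral.intervalIntegrable_cpow' (a := 0) (b := 1) (hre m)
    rw [intervalIntegrable_iff_integrableOn_Ioc_of_le zero_le_one] at this
    exact this.const_mul _
  have hnorm (m : ℕ) : ∫ t in Set.Ioc (0 : ℝ) 1, ‖(halfCoeff m : ℂ) * (t : ℂ) ^ (s - 1 + m)‖ =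
      halfCoeff m * (1 / (s.re + m)) := by
    rw [← hintn, intervalIntegral.integral_of_le zero_le_one, ← MeasureTheory.integral_const_mul]
    refine MeasureTheory.setIntegral_congr_fun measurableSet_Ioc fun t ht => ?_
    rw [norm_mul, Complex.norm_real, Real.norm_of_nonneg (halfCoeff_pos _).le,
      Complex.norm_cpow_eq_rpow_re_of_pos ht.1]
    simp
  have hsum : Summable fun m : ℕ =>
      ∫ t in Set.Ioc (0 : ℝ) 1, ‖(halfCoeff m : ℂ) * (t : ℂ) ^ (s - 1 + m)‖ := by
    simp_rw [hnorm]
    rw [← summable_nat_add_iff 1]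
    refine Summable.of_nonneg_of_le (fun m => ?_) (fun m => ?_) summable_halfCoeff_succ_div
    · have := halfCoeff_pos (m + 1)
      positivity
    · rw [mul_one_div]
      push_cast
      exact div_le_div_of_nonneg_left (halfCoeff_pos _).le (by positivity) (by linarith)
  -- Termwise integration of t^(s-1) ∑ c_m t^m: the L¹ norms c_m / (Re s + m) are summable.
  have h := MeasureTheory.hasSum_integral_of_summable_integral_norm hF hsum
  convert! h using 1
  · funext m
    rw [MeasureTheory.integral_const_mul, ← intervalIntegral.integral_of_le zero_le_one, hint,
      mul_one_div]
  -- The endpoint t = 1 is dropped, since the binomial series is summed only for |t| < 1.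
  · rw [Complex.betaIntegral.eq_1, intervalIntegral.integral_of_le zero_le_one,
      MeasureTheory.integral_Ioc_eq_integral_Ioo, MeasureTheory.integral_Ioc_eq_integral_Ioo]
    refine MeasureTheory.setIntegral_congr_fun measurableSet_Ioo fun t ht => ?_
    have ht0 : (t : ℂ) ≠ 0 := by exact_mod_cast ht.1.ne'
    have hb := hasSum_halfCoeff (x := (t : ℂ))
      (by rw [Complex.norm_real, Real.norm_of_nonneg ht.1.le]; exact ht.2)
    have hb' := hb.mul_left ((t : ℂ) ^ (s - 1))
    have e : (fun m : ℕ => (t : ℂ) ^ (s - 1) * ((halfCoeff m : ℂ) * (t : ℂ) ^ m)) =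
        fun m : ℕ => (halfCoeff m : ℂ) * (t : ℂ) ^ (s - 1 + m) := by
      funext m
      rw [Complex.cpow_add _ _ ht0, Complex.cpow_natCast]
      ring
    rw [e] at hb'
    rw [hb'.tsum_eq, show (1 / 2 - 1 : ℂ) = -(1 / 2) by norm_num, Complex.cpow_neg, inv_eq_one_div]

/-- Once (m + 1)/2 ≥ |s|, the denominator is at least (m + 1)/2 in modulus; the finitely many
earlier terms do not matter. -/
theorem summable_halfCoeff_div (s : ℂ) : Summable fun m : ℕ => (halfCoeff m : ℂ) / (s + m) := by
  rw [← summable_nat_add_iff 1]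
  have h : Tendsto (fun m : ℕ => ((m : ℝ) + 1) / 2) atTop atTop :=
    (tendsto_atTop_add_const_right _ _ tendsto_natCast_atTop_atTop).atTop_div_const two_pos
  refine Summable.of_norm_bounded_eventually_nat (summable_halfCoeff_succ_div.mul_left 2) ?_
  filter_upwards [h.eventually_ge_atTop ‖s‖] with m hm
  have h1 : ((m : ℝ) + 1) / 2 ≤ ‖s + ((m + 1 : ℕ) : ℂ)‖ := by
    have h2 : ‖((m + 1 : ℕ) : ℂ)‖ = (m : ℝ) + 1 := by rw [Complex.norm_natCast]; push_cast; rfl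
    have h3 := norm_sub_le (s + ((m + 1 : ℕ) : ℂ)) s
    rw [add_sub_cancel_left, h2] at h3
    linarith
  rw [norm_div, Complex.norm_real, Real.norm_of_nonneg (halfCoeff_pos _).le]
  calc _ ≤ halfCoeff (m + 1) / (((m : ℝ) + 1) / 2) :=
        div_le_div_of_nonneg_left (halfCoeff_pos _).le (by positivity) h1
    _ = _ := by field_simp

/-- The functional equation of the partial fraction series of `B(s, 1/2)`. -/
theorem mul_tsum_halfCoeff_div {s : ℂ} (hs : ∀ m : ℕ, s ≠ -m) :
    s * ∑' m : ℕ, (halfCoeff m : ℂ) / (s + m) =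
      (s + 1 / 2) * ∑' m : ℕ, (halfCoeff m : ℂ) / (s + 1 + m) := by
  have h1 := (summable_halfCoeff_div s).hasSum.mul_left s
  have h2 := (summable_halfCoeff_div (s + 1)).hasSum.mul_left (s + 1 / 2)
  have h := (h1.sub h2).tendsto_sum_nat
  -- The recurrence (M + 1) c_(M+1) = (M + 1/2) c_M telescopes the difference to one boundary term,
  -- which vanishes in the limit because c_M → 0.
  have e (M : ℕ) : ∑ m ∈ Finset.range M, (s * ((halfCoeff m : ℂ) / (s + m)) -
      (s + 1 / 2) * ((halfCoeff m : ℂ) / (s + 1 + m))) = (halfCoeff M : ℂ) * (M / (s + M)) := by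
    induction M with
    | zero => simp
    | succ M ih =>
      rw [Finset.sum_range_succ, ih]
      have ha := nat_add_ne_zero hs M
      have hb := nat_add_ne_zero hs (M + 1)
      have hc : ((M : ℂ) + 1) * halfCoeff (M + 1) = (M + 1 / 2) * halfCoeff M := by
        have := congrArg (fun r : ℝ => (r : ℂ)) (halfCoeff_succ_mul M)
        push_cast at this
        exact this
      push_cast at hb ⊢
      rw [show s + 1 + (M : ℂ) = s + (M + 1) by ring]
      have h1 : (halfCoeff M : ℂ) * (M / (s + M)) + s * (halfCoeff M / (s + M)) = halfCoeff M := by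
        field_simp
        ring
      have h2 : (s + 1 / 2) * ((halfCoeff M : ℂ) / (s + (M + 1))) +
          halfCoeff (M + 1) * ((M + 1) / (s + (M + 1))) = halfCoeff M := by
        field_simp
        linear_combination 2 * hc
      linear_combination h1 - h2
  simp_rw [e] at h
  have hlim : Tendsto (fun M : ℕ => (halfCoeff M : ℂ) * (M / (s + M))) atTop (𝓝 0) := by
    have hc : Tendsto (fun M : ℕ => (halfCoeff M : ℂ)) atTop (𝓝 ((0 : ℝ) : ℂ)) :=
      (Complex.continuous_ofReal.tendsto 0).comp tendsto_halfCoeff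
    have hd := tendsto_natCast_div_add_atTop (𝕜 := ℂ) s
    have := hc.mul hd
    simpa [add_comm] using this
  exact sub_eq_zero.1 (tendsto_nhds_unique h hlim)

theorem Gamma_one_half_eq_sqrt_pi : Complex.Gamma (1 / 2) = (Real.sqrt Real.pi : ℂ) := by
  rw [Complex.Gamma_one_half_eq, Real.sqrt_eq_rpow, Complex.ofReal_cpow Real.pi_pos.le]
  norm_num

/-- The partial fraction expansion of `Γ(s) √π / Γ(s + 1/2)`. -/
theorem tsum_halfCoeff_div {s : ℂ} (hs : ∀ m : ℕ, s ≠ -m) :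
    ∑' m : ℕ, (halfCoeff m : ℂ) / (s + m) =
      Complex.Gamma s * (Real.sqrt Real.pi : ℂ) * (Complex.Gamma (s + 1 / 2))⁻¹ := by
  -- Continuation to the left one unit strip at a time: both sides satisfy the same functional
  -- equation in s. Where Γ(s + 1/2) has a pole, its default value 0 has inverse 0, the true value
  -- of 1/Γ.
  obtain ⟨k, hk⟩ := exists_nat_gt (-s.re)
  induction k generalizing s with
  | zero =>
    have hs0 : 0 < s.re := by simpa using hk
    rw [(hasSum_halfCoeff_div_of_re_pos hs0).tsum_eq, ← Gamma_one_half_eq_sqrt_pi,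
      Complex.Gamma_mul_Gamma_eq_betaIntegral hs0 (by norm_num)]
    have : Complex.Gamma (s + 1 / 2) ≠ 0 := by
      refine Complex.Gamma_ne_zero_of_re_pos ?_
      simp only [Complex.add_re]
      norm_num
      linarith
    rw [mul_right_comm, mul_inv_cancel₀ this, one_mul]
  | succ k ih =>
    have hs1 : ∀ m : ℕ, s + 1 ≠ -m := by
      intro m h
      refine hs (m + 1) ?_
      push_cast
      linear_combination h
    have hs0 : s ≠ 0 := by simpa using hs 0
    have h1 := ih hs1 (by push_cast at hk; simp only [Complex.add_re, Complex.one_re]; linarith)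
    have h2 := mul_tsum_halfCoeff_div hs
    rw [h1, Complex.Gamma_add_one s hs0] at h2
    rw [Complex.one_div_Gamma_eq_self_mul_one_div_Gamma_add_one (s + 1 / 2)]
    refine mul_left_cancel₀ hs0 ?_
    rw [h2, show s + 1 + 1 / 2 = s + 1 / 2 + 1 by ring]
    ring

/-- The terms of the Apéry-like series are Beta values. -/
theorem aperyTerm_two_eq {a : ℂ} (ha : ∀ m : ℤ, a ≠ m) (z : ℂ) (n : ℤ) :
    aperyTerm 2 a z n = z ^ n *
      ((∑' m : ℕ, (halfCoeff m : ℂ) / ((n : ℂ) + a + m)) / ((n : ℂ) + a)) := by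
  have hs : ∀ m : ℕ, (n : ℂ) + a ≠ -m := by
    intro m h
    refine ha (-m - n) ?_
    push_cast
    linear_combination h
  rw [tsum_halfCoeff_div hs, aperyTerm, genBinom,
    show 2 * (n : ℂ) + 2 * a = 2 * ((n : ℂ) + a) by ring]
  set s := (n : ℂ) + a
  have hs0 : s ≠ 0 := by simpa using hs 0
  have hG : Complex.Gamma s ≠ 0 := Complex.Gamma_ne_zero hs
  have hdup := Complex.Gamma_mul_Gamma_add_half s
  have h2s : (2 : ℂ) ^ s ≠ 0 := by simp [Complex.cpow_eq_zero_iff]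
  have h4 : (4 : ℂ) ^ s = 2 ^ s * 2 ^ s := by
    have := Complex.natCast_mul_natCast_cpow 2 2 s
    norm_num at this
    exact this
  have h2 : (2 : ℂ) ^ (1 - 2 * s) = 2 / (2 ^ s * 2 ^ s) := by
    rw [Complex.cpow_sub _ _ two_ne_zero, Complex.cpow_one, two_mul,
      Complex.cpow_add _ _ two_ne_zero]
  rw [h2] at hdup
  rw [show 2 * s - s + 1 = s + 1 by ring, Complex.Gamma_add_one s hs0,
    Complex.Gamma_add_one (2 * s) (mul_ne_zero two_ne_zero hs0), h4]
  have hpi : (Real.sqrt Real.pi : ℂ) ≠ 0 := by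
    exact_mod_cast (Real.sqrt_pos.2 Real.pi_pos).ne'
  -- Here 2s is a pole of Γ: duplication forces s + 1/2 to be one as well, and both sides are 0 by
  -- the conventions for division.
  by_cases h0 : Complex.Gamma (2 * s) = 0
  · have : Complex.Gamma (s + 1 / 2) = 0 := by
      rw [h0, zero_mul, zero_mul] at hdup
      exact (mul_eq_zero.1 hdup).resolve_left hG
    rw [h0, this]
    simp
  · have h1 : Complex.Gamma (s + 1 / 2) ≠ 0 := by
      intro h
      rw [h, mul_zero] at hdup
      exact mul_ne_zero (mul_ne_zero h0 (div_ne_zero two_ne_zero (mul_ne_zero h2s h2s))) hpi hdup.symm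
    have h3 : Complex.Gamma s * Complex.Gamma (s + 1 / 2) * (2 ^ s * 2 ^ s) =
        2 * Complex.Gamma (2 * s) * Real.sqrt Real.pi := by
      rw [hdup]
      field_simp
    rw [mul_comm]
    congr 1
    rw [← div_eq_mul_inv, div_div]
    generalize Complex.Gamma (s + 1 / 2) = G at *
    generalize Complex.Gamma (2 * s) = H at *
    rw [div_eq_div_iff]
    · field_simp
      linear_combination h3
    · refine mul_ne_zero (pow_ne_zero _ hs0) (div_ne_zero ?_ ?_)
      · exact mul_ne_zero (mul_ne_zero two_ne_zero hs0) h0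
      · exact mul_ne_zero (mul_ne_zero hs0 hG) (mul_ne_zero hs0 hG)
    · exact mul_ne_zero h1 hs0

/-! ### Absolute convergence of the double series -/

theorem summable_norm_int_add_rpow_neg (a : ℂ) {p : ℝ} (hp : 1 < p) :
    Summable fun n : ℤ => ‖(n : ℂ) + a‖ ^ (-p) := by
  refine Summable.of_norm_bounded_eventually ((Real.summable_one_div_int_add_rpow a.re p).2 hp) ?_
  -- The comparison through |n + Re a| can fail only where this vanishes, which happens for at most
  -- one n.
  have hfin : {n : ℤ | (n : ℝ) + a.re = 0}.Finite := by
    refine Set.Subsingleton.finite fun n hn m hm => ?_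
    have : (n : ℝ) = m := by
      simp only [Set.mem_ofPred_eq] at hn hm
      linarith
    exact_mod_cast this
  filter_upwards [hfin.compl_mem_cofinite] with n hn
  have h1 : 0 < |(n : ℝ) + a.re| := abs_pos.2 hn
  have h2 : |(n : ℝ) + a.re| ≤ ‖(n : ℂ) + a‖ := by
    simpa using Complex.abs_re_le_norm ((n : ℂ) + a)
  rw [Real.norm_of_nonneg (by positivity), one_div, ← Real.rpow_neg h1.le]
  exact Real.rpow_le_rpow_of_nonpos h1 h2 (by linarith)

/-- The larger of A and B is at least M/2: its power 3/4 is traded for M, and its remaining power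
1/4 is passed to the smaller one. With M = m + 1 the exponent 5/4 > 1 suffices for the sum over n,
and 3/4 > 1/2 for the sum over m against c_(m+1). -/
theorem inv_mul_inv_le_rpow {A B M : ℝ} (hA : 0 < A) (hB : 0 < B) (hM : 0 < M) (h : M ≤ A + B) :
    A⁻¹ * B⁻¹ ≤ 2 * (M ^ (-(3 / 4) : ℝ) * (A ^ (-(5 / 4) : ℝ) + B ^ (-(5 / 4) : ℝ))) := by
  wlog hAB : A ≤ B generalizing A B
  · have := this hB hA (by linarith) (le_of_not_ge hAB)
    rwa [mul_comm, add_comm (A ^ _)]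
  have h1 : B ^ (-(3 / 4) : ℝ) ≤ 2 * M ^ (-(3 / 4) : ℝ) := by
    calc B ^ (-(3 / 4) : ℝ) ≤ (M / 2) ^ (-(3 / 4) : ℝ) :=
          Real.rpow_le_rpow_of_nonpos (by positivity) (by linarith) (by norm_num)
      _ = 2 ^ (3 / 4 : ℝ) * M ^ (-(3 / 4) : ℝ) := by
          rw [Real.div_rpow hM.le zero_le_two, Real.rpow_neg zero_le_two, div_inv_eq_mul, mul_comm]
      _ ≤ 2 * M ^ (-(3 / 4) : ℝ) := by
          refine mul_le_mul_of_nonneg_right ?_ (by positivity)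
          calc (2 : ℝ) ^ (3 / 4 : ℝ) ≤ 2 ^ (1 : ℝ) :=
                Real.rpow_le_rpow_of_exponent_le one_le_two (by norm_num)
            _ = 2 := Real.rpow_one 2
  have h2 : B ^ (-(1 / 4) : ℝ) ≤ A ^ (-(1 / 4) : ℝ) :=
    Real.rpow_le_rpow_of_nonpos hA hAB (by norm_num)
  have hB1 : B⁻¹ = B ^ (-(1 / 4) : ℝ) * B ^ (-(3 / 4) : ℝ) := by
    rw [← Real.rpow_add hB, ← Real.rpow_neg_one]; norm_num
  have hA1 : A ^ (-(5 / 4) : ℝ) = A⁻¹ * A ^ (-(1 / 4) : ℝ) := by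
    rw [← Real.rpow_neg_one, ← Real.rpow_add hA]; norm_num
  calc A⁻¹ * B⁻¹ ≤ A⁻¹ * (A ^ (-(1 / 4) : ℝ) * (2 * M ^ (-(3 / 4) : ℝ))) := by
        rw [hB1]; gcongr
    _ = 2 * (M ^ (-(3 / 4) : ℝ) * A ^ (-(5 / 4) : ℝ)) := by rw [hA1]; ring
    _ ≤ _ := by
        gcongr
        exact le_add_of_nonneg_right (by positivity)

theorem int_add_ne_zero {a : ℂ} (ha : ∀ m : ℤ, a ≠ m) (n : ℤ) : (n : ℂ) + a ≠ 0 := by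
  intro h
  refine ha (-n) ?_
  push_cast
  linear_combination h

theorem int_add_add_succ_ne_zero {a : ℂ} (ha : ∀ m : ℤ, a ≠ m) (n : ℤ) (m : ℕ) :
    (n : ℂ) + a + (m + 1) ≠ 0 := by
  have := int_add_ne_zero ha (n + m + 1)
  push_cast at this
  intro h
  exact this (by linear_combination h)

theorem summable_halfCoeff_double {x a : ℂ} (hx : ‖x‖ = 1) (ha : ∀ m : ℤ, a ≠ m) :
    Summable fun p : ℤ × ℕ => (halfCoeff (p.2 + 1) : ℂ) *
      (x ^ p.1 / (((p.1 : ℂ) + a) * ((p.1 : ℂ) + a + (p.2 + 1)))) := by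
  have hz := summable_norm_int_add_rpow_neg a (p := 5 / 4) (by norm_num)
  have hc := summable_halfCoeff_succ_mul_rpow (q := 3 / 4) (by norm_num)
  have h1 : Summable fun p : ℤ × ℕ => ‖(p.1 : ℂ) + a‖ ^ (-(5 / 4) : ℝ) *
      (halfCoeff (p.2 + 1) * ((p.2 : ℝ) + 1) ^ (-(3 / 4) : ℝ)) :=
    hz.mul_of_nonneg hc (fun n => by positivity)
      (fun n => mul_nonneg (halfCoeff_pos _).le (by positivity))
  -- This shear carries n + a to n + a + (m + 1), so the B-part of the bound is a reindexing of the
  -- A-part.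
  let e : ℤ × ℕ ≃ ℤ × ℕ :=
    { toFun := fun p => (p.1 + (p.2 + 1), p.2)
      invFun := fun p => (p.1 - (p.2 + 1), p.2)
      left_inv := fun p => by simp
      right_inv := fun p => by simp }
  have h2 := (e.summable_iff.2 h1)
  refine Summable.of_norm_bounded ((h1.add h2).mul_left 2) fun p => ?_
  obtain ⟨n, m⟩ := p
  have hA := norm_pos_iff.2 (int_add_ne_zero ha n)
  have hB := norm_pos_iff.2 (int_add_add_succ_ne_zero ha n m)
  have hM : (0 : ℝ) < m + 1 := by positivity
  have hMAB : (m : ℝ) + 1 ≤ ‖(n : ℂ) + a‖ + ‖(n : ℂ) + a + (m + 1)‖ := by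
    have h3 := norm_sub_le ((n : ℂ) + a + (m + 1)) ((n : ℂ) + a)
    have h4 : ‖(m : ℂ) + 1‖ = (m : ℝ) + 1 := by
      have := Complex.norm_natCast (m + 1)
      push_cast at this
      exact this
    rw [add_sub_cancel_left, h4] at h3
    linarith
  have hb := mul_le_mul_of_nonneg_left (inv_mul_inv_le_rpow hA hB hM hMAB)
    (halfCoeff_pos (m + 1)).le
  simp only [norm_mul, norm_div, norm_zpow, hx, one_zpow, Complex.norm_real,
    Real.norm_of_nonneg (halfCoeff_pos _).le, one_div, mul_inv, e, Function.comp_apply,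
    Equiv.coe_fn_mk]
  refine hb.trans (le_of_eq ?_)
  push_cast
  rw [show (n : ℂ) + (m + 1) + a = n + a + (m + 1) by ring]
  ring

/-! ### Convergence of the Hurwitz series -/

theorem hasSum_conditional_nat_iff {f : ℕ → ℂ} {l : ℂ} :
    HasSum f l (SummationFilter.conditional ℕ) ↔
      Tendsto (fun N => ∑ k ∈ Finset.range N, f k) atTop (𝓝 l) := by
  rw [HasSum, SummationFilter.conditional_filter_eq_map_range, tendsto_map'_iff]
  rfl

theorem summable_nat_add_norm_rpow {c : ℂ} (hc : ∀ m : ℤ, c ≠ m) :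
    Summable fun n : ℕ => ‖(n : ℂ) + c‖⁻¹ ^ 2 := by
  have h := (summable_norm_int_add_rpow_neg c (p := 2) (by norm_num)).comp_injective
    Nat.cast_injective
  refine h.congr fun n => ?_
  have h0 := norm_pos_iff.2 (int_add_ne_zero hc n)
  simp only [Int.cast_natCast] at h0
  simp only [Function.comp_apply, Int.cast_natCast]
  rw [Real.rpow_neg h0.le, inv_pow]
  norm_num

theorem summable_cycHurwitzTerm_two {x c : ℂ} (hx : ‖x‖ = 1) (hc : ∀ m : ℤ, c ≠ m) :
    Summable (cycHurwitzTerm 2 x c) := by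
  refine Summable.of_norm_bounded (summable_nat_add_norm_rpow hc) fun n => ?_
  rw [cycHurwitzTerm, norm_div, norm_pow, norm_pow, hx, one_pow, one_div, inv_pow]

theorem Summable.hasSum_conditional_nat {f : ℕ → ℂ} (hf : Summable f) :
    HasSum f (∑' n, f n) (SummationFilter.conditional ℕ) :=
  hasSum_conditional_nat_iff.2 hf.hasSum.tendsto_sum_nat

theorem summable_inv_mul_inv_nat {c d : ℂ} (hc : ∀ m : ℤ, c ≠ m) (hd : ∀ m : ℤ, d ≠ m) :
    Summable fun n : ℕ => ‖(n : ℂ) + c‖⁻¹ * ‖(n : ℂ) + d‖⁻¹ := by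
  refine Summable.of_nonneg_of_le (fun n => by positivity) (fun n => ?_)
    ((summable_nat_add_norm_rpow hc).add (summable_nat_add_norm_rpow hd))
  nlinarith [sq_nonneg (‖(n : ℂ) + c‖⁻¹ - ‖(n : ℂ) + d‖⁻¹), sq_nonneg ‖(n : ℂ) + c‖⁻¹,
    sq_nonneg ‖(n : ℂ) + d‖⁻¹]

theorem one_sub_ne_int {a : ℂ} (ha : ∀ m : ℤ, a ≠ m) (m : ℤ) : 1 - a ≠ m := by
  intro h
  refine ha (1 - m) ?_
  push_cast
  linear_combination -h

theorem tendsto_pow_div_nat_add_zero {x : ℂ} (hx : ‖x‖ = 1) (c : ℂ) (k : ℕ) :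
    Tendsto (fun N : ℕ => x ^ (N + k) / ((N : ℂ) + c)) atTop (𝓝 0) := by
  rw [tendsto_zero_iff_norm_tendsto_zero]
  have h : Tendsto (fun N : ℕ => ‖(N : ℂ) + c‖) atTop atTop := by
    refine tendsto_atTop_mono (f := fun N : ℕ => (N : ℝ) + (-‖c‖)) (fun N => ?_)
      (tendsto_atTop_add_const_right _ _ tendsto_natCast_atTop_atTop)
    have := norm_sub_le ((N : ℂ) + c) c
    rw [add_sub_cancel_right, Complex.norm_natCast] at this
    linarith
  refine h.inv_tendsto_atTop.congr fun N => ?_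
  rw [norm_div, norm_pow, hx, one_pow, one_div, Pi.inv_apply]

/-- Summation by parts: away from `x = 1`, the series of `Li_1` converges on the unit circle. -/
theorem cycHurwitzConverges_one {x c : ℂ} (hx : ‖x‖ = 1) (hx1 : x ≠ 1) (hc : ∀ m : ℤ, c ≠ m) :
    CycHurwitzConverges 1 x c := by
  have hc1 : ∀ m : ℤ, c + 1 ≠ m := by
    intro m h
    refine hc (m - 1) ?_
    push_cast
    linear_combination h
  have hn (k : ℕ) : (k : ℂ) + c ≠ 0 := by exact_mod_cast int_add_ne_zero hc k
  have hn1 (k : ℕ) : (k : ℂ) + (c + 1) ≠ 0 := by exact_mod_cast int_add_ne_zero hc1 k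
  have hs : Summable fun k : ℕ => x ^ (k + 2) * (1 / ((k : ℂ) + c) - 1 / ((k : ℂ) + (c + 1))) := by
    refine Summable.of_norm_bounded (summable_inv_mul_inv_nat hc hc1) fun k => ?_
    have : 1 / ((k : ℂ) + c) - 1 / ((k : ℂ) + (c + 1)) =
        ((k : ℂ) + c)⁻¹ * ((k : ℂ) + (c + 1))⁻¹ := by
      have h1 := hn k
      have h2 := hn1 k
      field_simp
      ring
    rw [this, norm_mul, norm_pow, hx, one_pow, one_mul, norm_mul, norm_inv, norm_inv]
  have hx1' : 1 - x ≠ 0 := sub_ne_zero.2 hx1.symm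
  -- The partial sum times 1 - x, with the terms regrouped: a vanishing boundary term and
  -- differences of size O(k^(-2)).
  have key (N : ℕ) : ∑ k ∈ Finset.range N, cycHurwitzTerm 1 x c k =
      (x / c - x ^ (N + 1) / (N + c) - ∑ k ∈ Finset.range N,
        x ^ (k + 2) * (1 / ((k : ℂ) + c) - 1 / ((k : ℂ) + (c + 1)))) / (1 - x) := by
    induction N with
    | zero => simp
    | succ N ih =>
      rw [Finset.sum_range_succ, ih, Finset.sum_range_succ, cycHurwitzTerm]
      have h1 := hn N
      have h2 := hn1 N
      push_cast
      rw [show (N : ℂ) + 1 + c = N + (c + 1) by ring]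
      rw [eq_div_iff hx1', add_mul, div_mul_cancel₀ _ hx1']
      simp only [div_eq_mul_inv, pow_one, one_mul]
      ring
  have hlim := (((tendsto_const_nhds (x := x / c)).sub (tendsto_pow_div_nat_add_zero hx c 1)).sub
    hs.hasSum.tendsto_sum_nat).div_const (1 - x)
  simp_rw [← key] at hlim
  exact ⟨_, hasSum_conditional_nat_iff.2 hlim⟩

/-- The two divergent series combine into terms (2a - 1) / ((n + 1 - a)(n + a)), which are
O(n^(-2)). The factors `1 *` and `1⁻¹` match the general expression at x = 1. -/
theorem summable_cycHurwitzTerm_one_sub {a : ℂ} (ha : ∀ m : ℤ, a ≠ m) :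
    Summable fun n : ℕ =>
      cycHurwitzTerm 1 1 (1 - a) n - 1 * cycHurwitzTerm 1 (1 : ℂ)⁻¹ a n := by
  have ha' := one_sub_ne_int ha
  refine Summable.of_norm_bounded ((summable_inv_mul_inv_nat ha' ha).mul_left ‖2 * a - 1‖)
    fun n => ?_
  have h1 : (n : ℂ) + (1 - a) ≠ 0 := by exact_mod_cast int_add_ne_zero ha' n
  have h2 : (n : ℂ) + a ≠ 0 := by exact_mod_cast int_add_ne_zero ha n
  have : cycHurwitzTerm 1 1 (1 - a) n - 1 * cycHurwitzTerm 1 (1 : ℂ)⁻¹ a n =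
      (2 * a - 1) * (((n : ℂ) + (1 - a))⁻¹ * ((n : ℂ) + a)⁻¹) := by
    simp only [cycHurwitzTerm, inv_one, one_pow, pow_one, one_mul]
    field_simp
    ring
  rw [this, norm_mul, norm_mul, norm_inv, norm_inv]

/-! ### Bilateral sums over the integers -/

/-- The indices n ≥ 0 give x Li_2(x⁻¹; a); the indices n = -(k + 1) give Li_2(x; 1 - a), the sign of
the denominator disappearing in the square. -/
theorem hasSum_zpow_div_sq {x a : ℂ} (hx : ‖x‖ = 1) (ha : ∀ m : ℤ, a ≠ m) :
    HasSum (fun n : ℤ => x⁻¹ ^ n / ((n : ℂ) + a) ^ 2)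
      (cycHurwitz 2 x (1 - a) + x * cycHurwitz 2 x⁻¹ a) := by
  have hx0 : x ≠ 0 := by rintro rfl; simp at hx
  have hxi : ‖x⁻¹‖ = 1 := by rw [norm_inv, hx, inv_one]
  have s1 := summable_cycHurwitzTerm_two hx (one_sub_ne_int ha)
  have s2 := summable_cycHurwitzTerm_two hxi ha
  have e1 : cycHurwitz 2 x (1 - a) = ∑' n, cycHurwitzTerm 2 x (1 - a) n :=
    s1.hasSum_conditional_nat.tsum_eq
  have e2 : cycHurwitz 2 x⁻¹ a = ∑' n, cycHurwitzTerm 2 x⁻¹ a n :=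
    s2.hasSum_conditional_nat.tsum_eq
  rw [e1, e2, add_comm]
  refine HasSum.of_nat_of_neg_add_one ?_ ?_
  · convert! s2.hasSum.mul_left x using 1
    funext n
    rw [cycHurwitzTerm, pow_succ x⁻¹, zpow_natCast, Int.cast_natCast, mul_div_assoc',
      mul_left_comm, mul_inv_cancel₀ hx0, mul_one]
  · convert! s1.hasSum using 1
    funext n
    rw [cycHurwitzTerm, inv_zpow', neg_neg]
    have : x ^ ((n : ℤ) + 1) = x ^ (n + 1) := by exact_mod_cast zpow_natCast x (n + 1)
    rw [this]
    push_cast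
    congr 1
    ring

/-- The bilateral sum of x^(-n) / (n + a) need not converge absolutely, but its difference with the
unit shift does. Its value may therefore be read off along the blocks -N ≤ n < N, where only the
conditional limit L is needed. -/
theorem hasSum_zpow_mul_sub_one {x a L : ℂ} (hx : ‖x‖ = 1) (ha : ∀ m : ℤ, a ≠ m)
    (hL : HasSum (fun n : ℕ => cycHurwitzTerm 1 x (1 - a) n - x * cycHurwitzTerm 1 x⁻¹ a n) L
      (SummationFilter.conditional ℕ)) :
    HasSum (fun n : ℤ => x⁻¹ ^ n * (1 / ((n : ℂ) + a) - 1 / ((n : ℂ) + a + 1)))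
      (-L * (1 - x)) := by
  have hx0 : x ≠ 0 := by rintro rfl; simp at hx
  have hxi : ‖x⁻¹‖ = 1 := by rw [norm_inv, hx, inv_one]
  -- Up to the factor c_1 this is the column m = 0 of the double series.
  have hs : Summable fun n : ℤ => x⁻¹ ^ n * (1 / ((n : ℂ) + a) - 1 / ((n : ℂ) + a + 1)) := by
    have h := (summable_halfCoeff_double hxi ha).comp_injective
      (Prod.mk_left_injective 0 : Function.Injective fun n : ℤ => (n, (0 : ℕ)))
    have h0 : ((halfCoeff 1 : ℝ) : ℂ) ≠ 0 := by exact_mod_cast (halfCoeff_pos 1).ne'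
    refine (h.mul_left (((halfCoeff 1 : ℝ) : ℂ)⁻¹)).congr fun n => ?_
    have h1 := int_add_ne_zero ha n
    have h2 := int_add_add_succ_ne_zero ha n 0
    simp only [Nat.cast_zero, zero_add] at h2
    simp only [Function.comp_apply, Nat.cast_zero, zero_add]
    rw [inv_mul_cancel_left₀ h0]
    field_simp
    ring
  have h1 := hs.hasSum.nat_add_neg_add_one.tendsto_sum_nat
  -- The shift leaves one boundary term at each end of the block, and both tend to 0.
  have key (N : ℕ) : ∑ k ∈ Finset.range N,
      ((x⁻¹ ^ (k : ℤ) * (1 / (((k : ℤ) : ℂ) + a) - 1 / (((k : ℤ) : ℂ) + a + 1))) +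
        (x⁻¹ ^ (-((k : ℤ) + 1)) * (1 / (((-((k : ℤ) + 1) : ℤ) : ℂ) + a) -
          1 / (((-((k : ℤ) + 1) : ℤ) : ℂ) + a + 1)))) =
      -(∑ k ∈ Finset.range N,
        (cycHurwitzTerm 1 x (1 - a) k - x * cycHurwitzTerm 1 x⁻¹ a k)) * (1 - x) -
        (x * (x⁻¹ ^ (N + 0) / ((N : ℂ) + a)) + x ^ (N + 1) / ((N : ℂ) + -a)) := by
    induction N with
    | zero =>
      simp only [Finset.range_zero, Finset.sum_empty, Nat.cast_zero, zero_add, pow_zero, pow_one,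
        neg_zero, zero_mul, div_neg]
      ring
    | succ N ih =>
      rw [Finset.sum_range_succ, ih, Finset.sum_range_succ, cycHurwitzTerm, cycHurwitzTerm]
      have hz : x⁻¹ ^ (-((N : ℤ) + 1)) = x ^ (N + 1) := by
        rw [inv_zpow', neg_neg]
        exact_mod_cast zpow_natCast x (N + 1)
      rw [hz, zpow_natCast]
      push_cast
      have g1 : (-((N : ℂ) + 1) + a)⁻¹ = -((N : ℂ) + (1 - a))⁻¹ := by
        rw [← inv_neg]; congr 1; ring
      have g2 : (-((N : ℂ) + 1) + a + 1)⁻¹ = -((N : ℂ) + -a)⁻¹ := by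
        rw [← inv_neg]; congr 1; ring
      have g3 : (N : ℂ) + 1 + -a = N + (1 - a) := by ring
      have g4 : (N : ℂ) + 1 + a = N + a + 1 := by ring
      have g5 : x⁻¹ ^ (N + 1) * x = x⁻¹ ^ N := by
        rw [pow_succ, mul_assoc, inv_mul_cancel₀ hx0, mul_one]
      have g6 : x ^ (N + 1 + 1) = x ^ (N + 1) * x := pow_succ _ _
      simp only [div_eq_mul_inv, pow_one, one_mul, add_zero]
      rw [g1, g2, g3, g4, g6]
      generalize ((N : ℂ) + (1 - a))⁻¹ = A
      generalize ((N : ℂ) + -a)⁻¹ = B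
      generalize ((N : ℂ) + a)⁻¹ = C
      generalize ((N : ℂ) + a + 1)⁻¹ = D
      rw [← g5]
      ring
  simp_rw [key] at h1
  have h2 := (((hasSum_conditional_nat_iff.1 hL).neg).mul_const (1 - x)).sub
    (((tendsto_pow_div_nat_add_zero hxi a 0).const_mul x).add
      (tendsto_pow_div_nat_add_zero hx (-a) 1))
  rw [mul_zero, add_zero, sub_zero] at h2
  rw [← tendsto_nhds_unique h1 h2]
  exact hs.hasSum

/-- Iterated unit shifts: 1 - x^(m+1) = (1 - x) + x (1 - x^m). -/
theorem hasSum_zpow_mul_sub {x a L : ℂ} (hx : ‖x‖ = 1) (ha : ∀ m : ℤ, a ≠ m)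
    (hL : HasSum (fun n : ℕ => cycHurwitzTerm 1 x (1 - a) n - x * cycHurwitzTerm 1 x⁻¹ a n) L
      (SummationFilter.conditional ℕ)) (m : ℕ) :
    HasSum (fun n : ℤ => x⁻¹ ^ n * (1 / ((n : ℂ) + a) - 1 / ((n : ℂ) + a + m)))
      (-L * (1 - x ^ m)) := by
  have hx0 : x ≠ 0 := by rintro rfl; simp at hx
  induction m with
  | zero => simp
  | succ m ih =>
    have h1 := ((Equiv.addRight (1 : ℤ)).hasSum_iff.2 ih).mul_left x
    have h2 := (hasSum_zpow_mul_sub_one hx ha hL).add h1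
    convert! h2 using 1
    · funext n
      simp only [Function.comp_apply, Equiv.coe_addRight]
      rw [zpow_add₀ (inv_ne_zero hx0), zpow_one]
      push_cast
      rw [show (n : ℂ) + 1 + a = n + a + 1 by ring,
        show (n : ℂ) + a + (m + 1) = n + a + 1 + m by ring]
      field_simp
      ring
    · ring

/-! ### Interchange of summations -/

/-- Convergence is assumed only for the difference of the Li_1 terms, so that x = 1 is covered
together with the other x. -/
theorem hasSum_aperyTerm {x a L : ℂ} (hx : ‖x‖ = 1) (ha : ∀ m : ℤ, a ≠ m)
    (hL : HasSum (fun n : ℕ => cycHurwitzTerm 1 x (1 - a) n - x * cycHurwitzTerm 1 x⁻¹ a n) L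
      (SummationFilter.conditional ℕ)) :
    HasSum (fun n : ℤ => aperyTerm 2 a x⁻¹ n)
      (cycHurwitz 2 x (1 - a) + x * cycHurwitz 2 x⁻¹ a
        - 2 * L * Complex.log (1 + (1 - x) ^ (1 / 2 : ℂ))) := by
  have hxi : ‖x⁻¹‖ = 1 := by rw [norm_inv, hx, inv_one]
  have hg := summable_halfCoeff_double hxi ha
  -- The term m = 0 of the Beta expansion is removed: it contributes 1 / (n + a)^2 and is summed
  -- separately.
  have hrow (n : ℤ) : HasSum (fun m : ℕ => (halfCoeff (m + 1) : ℂ) *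
      (x⁻¹ ^ n / (((n : ℂ) + a) * ((n : ℂ) + a + (m + 1)))))
      (aperyTerm 2 a x⁻¹ n - x⁻¹ ^ n / ((n : ℂ) + a) ^ 2) := by
    have hn := int_add_ne_zero ha n
    have h := ((hasSum_nat_add_iff' 1).2 (summable_halfCoeff_div ((n : ℂ) + a)).hasSum).mul_left
      (x⁻¹ ^ n / ((n : ℂ) + a))
    rw [aperyTerm_two_eq ha]
    convert! h using 1
    · funext m
      have := int_add_add_succ_ne_zero ha n m
      push_cast
      field_simp
    · simp only [Finset.range_one, Finset.sum_singleton, halfCoeff, Nat.cast_zero, add_zero,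
        Complex.ofReal_one]
      field_simp
  have hcol (m : ℕ) : HasSum (fun n : ℤ => (halfCoeff (m + 1) : ℂ) *
      (x⁻¹ ^ n / (((n : ℂ) + a) * ((n : ℂ) + a + (m + 1)))))
      (-L * (((halfCoeff (m + 1) / ((m : ℝ) + 1) : ℝ) : ℂ) * (1 - x ^ (m + 1)))) := by
    have h := (hasSum_zpow_mul_sub hx ha hL (m + 1)).mul_left
      (((halfCoeff (m + 1) / ((m : ℝ) + 1) : ℝ) : ℂ))
    have hm : (m : ℂ) + 1 ≠ 0 := by exact_mod_cast m.succ_ne_zero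
    convert! h using 1
    · funext n
      have h1 := int_add_ne_zero ha n
      have h2 := int_add_add_succ_ne_zero ha n m
      push_cast
      field_simp
      ring
    · ring
  have h1 := hg.hasSum.prod_fiberwise hrow
  have h2 := ((Equiv.prodComm ℕ ℤ).hasSum_iff.2 hg.hasSum).prod_fiberwise hcol
  have h3 := (hasSum_halfCoeff_div_mul_one_sub_pow hx.le).mul_left (-L)
  rw [h2.unique h3] at h1
  convert! (hasSum_zpow_div_sq hx ha).add h1 using 1
  · funext n; ring
  · ring

end

theorem mainTheorem5 (x : ℂ) (hx : ∃ N : ℕ, 0 < N ∧ x ^ N = 1)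
    (a : ℂ) (ha : ∀ m : ℤ, a ≠ (m : ℂ)) :
    -- the series that define the dilogarithmic terms converge
    (CycHurwitzConverges 2 x (1 - a) ∧ CycHurwitzConverges 2 x⁻¹ a) ∧
    -- the case of a root of unity other than one
    (x ≠ 1 →
      (CycHurwitzConverges 1 x (1 - a) ∧ CycHurwitzConverges 1 x⁻¹ a) ∧
      HasSum (fun n : ℤ => aperyTerm 2 a x⁻¹ n)
        (cycHurwitz 2 x (1 - a) + x * cycHurwitz 2 x⁻¹ a
          - 2 * (cycHurwitz 1 x (1 - a) - x * cycHurwitz 1 x⁻¹ a)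
            * Complex.log (1 + (1 - x) ^ (1 / 2 : ℂ)))) ∧
    -- the case of one, where the difference of the two divergent series is summed termwise
    (x = 1 →
      ∃ L : ℂ,
        HasSum (fun n : ℕ => cycHurwitzTerm 1 x (1 - a) n - x * cycHurwitzTerm 1 x⁻¹ a n) L
          (SummationFilter.conditional ℕ) ∧
        HasSum (fun n : ℤ => aperyTerm 2 a x⁻¹ n)
          (cycHurwitz 2 x (1 - a) + x * cycHurwitz 2 x⁻¹ a
            - 2 * L * Complex.log (1 + (1 - x) ^ (1 / 2 : ℂ)))) := by
  obtain ⟨N, hN, hxN⟩ := hx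
  have hn : ‖x‖ = 1 := Complex.norm_eq_one_of_pow_eq_one hxN hN.ne'
  have hni : ‖x⁻¹‖ = 1 := by rw [norm_inv, hn, inv_one]
  have ha' := one_sub_ne_int ha
  refine ⟨⟨⟨_, (summable_cycHurwitzTerm_two hn ha').hasSum_conditional_nat⟩,
    ⟨_, (summable_cycHurwitzTerm_two hni ha).hasSum_conditional_nat⟩⟩, fun hx1 => ?_, fun hx1 => ?_⟩
  · have h1 := cycHurwitzConverges_one hn hx1 ha'
    have h2 := cycHurwitzConverges_one hni (by simpa using hx1) ha
    -- For x ≠ 1 both Li_1 series converge, so L is the difference of their limits.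
    exact ⟨⟨h1, h2⟩, hasSum_aperyTerm hn ha (h1.hasSum.sub (h2.hasSum.mul_left x))⟩
  · subst hx1
    have hL := (summable_cycHurwitzTerm_one_sub ha).hasSum_conditional_nat
    exact ⟨_, hL, hasSum_aperyTerm hn ha hL⟩
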